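/- For a Boolean algebra $B$ and $1\le n<\omega$, let $d_n(B)$ be the least cardinal $\mu$ such that $B\setminus\{0\}$ is the union of $\mu$ sets each of which has the $n$-intersection property (the meet of any $n$ of its elements, repetitions allowed, is nonzero); let $d(B)$ be the topological density of $B$, i.e. the least cardinality of a dense subset of the Stone space of $B$. **Theorem.** Let $\kappa$ and $\theta$ be infinite cardinals, $\theta$ regular, with $\theta^\kappa=\theta$. Then there are Boolean algebras $B_\gamma$ ($\gamma<\kappa$), each of cardinality $2^\theta$, such that $$d(B_\gamma)=d_2(B_\gamma)=\theta^+\quad\text{for all }\gamma<\kappa,$$ and $$d\Big(\prod_{\gamma<\kappa}B_\gamma/D\Big)\le\theta\quad\text{for every non-principal ultrafilter } D \text{ on }\kappa .$$ In particular (for $\kappa=\aleph_0$ and $\theta=(2^{\aleph_0})^+$) there are Boolean algebras $B_n$ ($n<\omega$) of cardinality $2^{(2^{\aleph_0})^+}$ with $d(B_n)=d_2(B_n)=(2^{\aleph_0})^{++}$ such that $d(\prod_{n<\omega}B_n/D)\le(2^{\aleph_0})^+$ for every non-principal ultrafilter $D$ on $\omega$. -/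

import Mathlib

open Cardinal Order

universe u

/-- The set of ultrafilters of a Boolean algebra `B`, i.e. of its prime filters. -/
def UltSpace (B : Type*) [BooleanAlgebra B] : Type _ :=
  {F : Order.PFilter B // F.IsPrime}

/-- The Stone topology on `UltSpace B`, generated by the sets of all ultrafilters containing a
given element `b`. -/
instance UltSpace.instTopologicalSpace (B : Type*) [BooleanAlgebra B] :
    TopologicalSpace (UltSpace B) :=
  TopologicalSpace.generateFrom {U | ∃ b : B, U = {F : UltSpace B | b ∈ F.1}}

/-- The topological density `d(B)`: the least cardinality of a dense subset of the Stone space. -/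
noncomputable def topDensity (B : Type*) [BooleanAlgebra B] : Cardinal :=
  sInf {c | ∃ S : Set (UltSpace B), Dense S ∧ #S = c}

/-- The sentences `φ₀, φ₁, φ₂, …` about a Boolean algebra `B` with a distinguished subset `P₀` and
a binary relation `P₁`. For `y ∈ P₀` write `X_y = {x | P₁ y x}`. Then `φ₀` says that the union of
the sets `X_y` is `B \ {0}`, and `φₖ` for `k > 0` says that in each `X_y` the meet of any `k + 1`
elements is nonzero. -/
def densitySentence {B : Type*} [BooleanAlgebra B] (P₀ : Set B) (P₁ : B → B → Prop) : ℕ → Prop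
  | 0 => (∀ x : B, x ≠ ⊥ → ∃ y ∈ P₀, P₁ y x) ∧ ∀ x : B, ∀ y ∈ P₀, P₁ y x → x ≠ ⊥
  | k + 1 => ∀ x : Fin (k + 2) → B, ∀ y ∈ P₀, (∀ i, P₁ y (x i)) → Finset.univ.inf x ≠ ⊥

/-- The invariant `dₙ(B)` for `n ≤ ω`: the least cardinality of `P₀` in a model `(B, P₀, P₁)` of
`{φₖ | k < n}`. For `1 ≤ n < ω` it is the least number of sets with the `n`-intersection property
whose union is `B \ {0}`. -/
noncomputable def finDensity (n : ℕ∞) (B : Type*) [BooleanAlgebra B] : Cardinal :=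
  sInf {c | ∃ (P₀ : Set B) (P₁ : B → B → Prop),
    (∀ k : ℕ, (k : ℕ∞) < n → densitySentence P₀ P₁ k) ∧ #P₀ = c}

namespace UltSpace

variable {B : Type*} [BooleanAlgebra B]

theorem bot_not_mem (F : UltSpace B) : (⊥ : B) ∉ F.1 := fun h => by
  obtain ⟨x, hx⟩ := (Order.IsIdeal.toIdeal F.2.compl_ideal).nonempty
  exact hx (Order.PFilter.mem_of_le bot_le h)

/-- Every centered set is contained in an ultrafilter. -/
theorem exists_of_centered (X : Set B)
    (hX : ∀ s : Finset B, (s : Set B) ⊆ X → s.inf id ≠ ⊥) :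
    ∃ F : UltSpace B, ∀ x ∈ X, x ∈ F.1 := by
  classical
  let G : Set B := {b | ∃ s : Finset B, (s : Set B) ⊆ X ∧ s.inf id ≤ b}
  have hG : Order.IsPFilter G := by
    refine .of_def ⟨⊤, ∅, by simp, le_top⟩ ?_ ?_
    · rintro a ⟨s, hs, ha⟩ b ⟨t, ht, hb⟩
      refine ⟨a ⊓ b, ⟨s ∪ t, by simp [hs, ht], ?_⟩, inf_le_left, inf_le_right⟩
      rw [Finset.inf_union]
      exact inf_le_inf ha hb
    · rintro a b hab ⟨s, hs, ha⟩
      exact ⟨s, hs, ha.trans hab⟩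
  have hdisj : Disjoint ((hG.toPFilter : Order.PFilter B) : Set B)
      ((Order.Ideal.principal (⊥ : B)) : Set B) := by
    refine Set.disjoint_left.2 fun b hb hb' => ?_
    obtain ⟨s, hs, hsb⟩ : b ∈ G := hb
    exact hX s hs (le_bot_iff.1 (hsb.trans hb'))
  obtain ⟨J, hJ, -, hGJ⟩ := DistribLattice.prime_ideal_of_disjoint_filter_ideal hdisj
  refine ⟨⟨hJ.toPrimePair.F, hJ.toPrimePair.F_isPrime⟩, fun x hx => ?_⟩
  have : x ∈ G := ⟨{x}, by simpa using hx, by simp⟩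
  exact Set.disjoint_left.1 hGJ this

theorem dense_iff (S : Set (UltSpace B)) :
    Dense S ↔ ∀ b : B, b ≠ ⊥ → ∃ F ∈ S, b ∈ F.1 := by
  have hbasis : TopologicalSpace.IsTopologicalBasis
      {U | ∃ b : B, U = {F : UltSpace B | b ∈ F.1}} := by
    refine ⟨?_, ?_, rfl⟩
    · rintro _ ⟨a, rfl⟩ _ ⟨b, rfl⟩ F ⟨ha, hb⟩
      exact ⟨_, ⟨a ⊓ b, rfl⟩, Order.PFilter.inf_mem ha hb, fun G hG =>
        ⟨Order.PFilter.mem_of_le inf_le_left hG, Order.PFilter.mem_of_le inf_le_right hG⟩⟩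
    · refine Set.eq_univ_of_forall fun F => ⟨_, ⟨⊤, rfl⟩, ?_⟩
      exact Order.PFilter.top_mem
  rw [hbasis.dense_iff]
  constructor
  · intro h b hb
    obtain ⟨F, hF⟩ := exists_of_centered {b} fun s hs => by
      rcases Finset.subset_singleton_iff.1 (by exact_mod_cast hs : s ⊆ {b}) with rfl | rfl
      · intro h0
        exact hb (le_bot_iff.1 (le_top.trans h0.le))
      · simpa using hb
    obtain ⟨G, hG, hGS⟩ := h _ ⟨b, rfl⟩ ⟨F, hF b rfl⟩
    exact ⟨G, hGS, hG⟩
  · rintro h _ ⟨b, rfl⟩ ⟨F, hF⟩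
    obtain ⟨G, hGS, hG⟩ := h b fun hb => F.bot_not_mem (hb ▸ hF)
    exact ⟨G, hG, hGS⟩

end UltSpace

/-- The topological density is the limit case `n = ω` of the invariants `dₙ`. -/
theorem topDensity_eq_finDensity (B : Type*) [BooleanAlgebra B] :
    topDensity B = finDensity ⊤ B := by
  classical
  apply le_antisymm
  · refine le_csInf ?_ ?_
    · refine ⟨_, {x | x ≠ ⊥}, fun y x => x ≠ ⊥ ∧ x = y, ?_, rfl⟩
      rintro (_ | k) -
      · exact ⟨fun x hx => ⟨x, hx, hx, rfl⟩, fun x y _ h => h.1⟩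
      · intro x y hy h h0
        apply hy
        rw [← le_bot_iff, ← h0]
        exact Finset.le_inf fun i _ => (h i).2.ge
    · rintro _ ⟨P₀, P₁, hP, rfl⟩
      have hU : ∀ y : P₀, (∃ x, P₁ y x) → ∃ F : UltSpace B, ∀ x, P₁ y x → x ∈ F.1 := by
        rintro y ⟨x₀, hx₀⟩
        refine UltSpace.exists_of_centered {x | P₁ y x} fun s hs h0 => ?_
        let t : Finset B := insert x₀ s
        have ht : ∀ x ∈ t, P₁ y x := by
          intro x hx
          rcases Finset.mem_insert.1 hx with rfl | hx
          · exact hx₀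
          · exact hs hx
        let e : Fin (t.card + 2) → B := fun i =>
          if h : (i : ℕ) < t.card then (t.equivFin.symm ⟨i, h⟩ : B) else x₀
        refine hP (t.card + 1) (ENat.natCast_lt_top _) e y y.2 (fun i => ?_) ?_
        · simp only [e]
          split_ifs
          · exact ht _ (Finset.coe_mem _)
          · exact hx₀
        · rw [← le_bot_iff, ← h0]
          refine Finset.le_inf fun x hx => ?_
          let j := t.equivFin ⟨x, Finset.mem_insert_of_mem hx⟩
          refine (Finset.inf_le (Finset.mem_univ (⟨j, by omega⟩ : Fin (t.card + 2)))).trans ?_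
          simp [e, j]
      choose F hF using hU
      let S : Set (UltSpace B) := Set.range fun y : {y : P₀ // ∃ x, P₁ y x} => F y.1 y.2
      have hS : Dense S := by
        rw [UltSpace.dense_iff]
        intro b hb
        obtain ⟨y, hy, hyb⟩ := (hP 0 (ENat.natCast_lt_top _)).1 b hb
        exact ⟨F ⟨y, hy⟩ ⟨b, hyb⟩, ⟨⟨⟨y, hy⟩, b, hyb⟩, rfl⟩, hF _ _ _ hyb⟩
      exact le_trans (csInf_le' ⟨S, hS, rfl⟩) (mk_range_le.trans (mk_subtype_le _))
  · refine le_csInf ?_ ?_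
    · exact ⟨_, Set.univ, dense_univ, rfl⟩
    rintro _ ⟨S, hS, rfl⟩
    rw [UltSpace.dense_iff] at hS
    choose G hGS hG using hS
    -- a dense subset with at most as many elements as there are elements of `B`
    let T : Set (UltSpace B) := Set.range fun b : {b : B // b ≠ ⊥} => G b.1 b.2
    have hTS : T ⊆ S := by
      rintro _ ⟨b, rfl⟩
      exact hGS _ _
    have hpick : ∀ t : T, ∃ b : {b : B // b ≠ ⊥}, G b.1 b.2 = t := fun t => t.2
    choose p hp using hpick
    have hpi : Function.Injective fun t : T => (p t : B) := by
      intro t t' h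
      have h' : p t = p t' := Subtype.ext h
      apply Subtype.ext
      rw [← hp t, ← hp t', h']
    have hmem : ∀ (t : T) (b : B), (∃ h : (p t : B) ≠ ⊥, b ∈ (G (p t) h).1) ↔ b ∈ t.1.1 := by
      intro t b
      rw [← hp t]
      exact ⟨fun ⟨_, h⟩ => h, fun h => ⟨(p t).2, h⟩⟩
    refine le_trans (csInf_le' ⟨Set.range fun t : T => (p t : B),
      fun y x => ∃ h : y ≠ ⊥, x ∈ (G y h).1, ?_, rfl⟩)
      (mk_range_le.trans (mk_le_mk_of_subset hTS))
    rintro (_ | k) -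
    · refine ⟨fun x hx => ⟨_, ⟨⟨G x hx, ⟨x, hx⟩, rfl⟩, rfl⟩, (hmem _ x).2 (hG x hx)⟩, ?_⟩
      rintro x y - ⟨h, hx⟩ rfl
      exact UltSpace.bot_not_mem _ hx
    · rintro x y - hx h0
      obtain ⟨h, -⟩ := hx 0
      apply UltSpace.bot_not_mem (G y h)
      rw [← h0]
      exact Finset.inf_induction Order.PFilter.top_mem
        (fun a ha b hb => Order.PFilter.inf_mem ha hb) fun i _ => (hx i).2

namespace Filter.Product

variable {ι : Type*} {D : Filter ι} {B : ι → Type*} [∀ i, BooleanAlgebra (B i)]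

/-- The reduced product `∏ i, B i / D` of Boolean algebras, with the operations induced by the
coordinatewise ones. It is the ultraproduct when `D` is an ultrafilter. -/
instance instBooleanAlgebra : BooleanAlgebra (D.Product B) where
  le x y := Quotient.liftOn₂' x y (fun f g => ∀ᶠ i in D, f i ≤ g i) (by
    intro f g f' g' hf hg
    refine propext (Filter.eventually_congr ?_)
    filter_upwards [hf, hg] with i h₁ h₂
    rw [h₁, h₂])
  sup := Quotient.map₂ (fun f g i => f i ⊔ g i) (by
    intro f f' hf g g' hg
    filter_upwards [hf, hg] with i h₁ h₂
    rw [h₁, h₂])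
  inf := Quotient.map₂ (fun f g i => f i ⊓ g i) (by
    intro f f' hf g g' hg
    filter_upwards [hf, hg] with i h₁ h₂
    rw [h₁, h₂])
  compl := Quotient.map (fun f i => (f i)ᶜ) (by
    intro f f' hf
    filter_upwards [hf] with i h
    rw [h])
  top := Quotient.mk'' fun _ => ⊤
  bot := Quotient.mk'' fun _ => ⊥
  le_refl x := Quotient.inductionOn' x fun f => Eventually.of_forall fun i => le_rfl
  le_trans x y z := Quotient.inductionOn₃' x y z fun f g h h₁ h₂ => by
    filter_upwards [h₁, h₂] with i h₁ h₂ using h₁.trans h₂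
  le_antisymm x y := Quotient.inductionOn₂' x y fun f g h₁ h₂ => Quotient.sound' (by
    filter_upwards [h₁, h₂] with i h₁ h₂ using h₁.antisymm h₂)
  le_sup_left x y := Quotient.inductionOn₂' x y fun f g =>
    Eventually.of_forall fun i => le_sup_left
  le_sup_right x y := Quotient.inductionOn₂' x y fun f g =>
    Eventually.of_forall fun i => le_sup_right
  sup_le x y z := Quotient.inductionOn₃' x y z fun f g h h₁ h₂ => by
    filter_upwards [h₁, h₂] with i h₁ h₂ using sup_le h₁ h₂
  inf_le_left x y := Quotient.inductionOn₂' x y fun f g =>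
    Eventually.of_forall fun i => inf_le_left
  inf_le_right x y := Quotient.inductionOn₂' x y fun f g =>
    Eventually.of_forall fun i => inf_le_right
  le_inf x y z := Quotient.inductionOn₃' x y z fun f g h h₁ h₂ => by
    filter_upwards [h₁, h₂] with i h₁ h₂ using le_inf h₁ h₂
  le_sup_inf x y z := Quotient.inductionOn₃' x y z fun f g h =>
    Eventually.of_forall fun i => le_sup_inf
  inf_compl_le_bot x := Quotient.inductionOn' x fun f =>
    Eventually.of_forall fun i => (inf_compl_self (f i)).le
  top_le_sup_compl x := Quotient.inductionOn' x fun f =>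
    Eventually.of_forall fun i => sup_compl_eq_top.ge
  le_top x := Quotient.inductionOn' x fun f => Eventually.of_forall fun i => le_top
  sdiff_eq _ _ := rfl
  himp_eq _ _ := rfl
  bot_le x := Quotient.inductionOn' x fun f => Eventually.of_forall fun i => bot_le

end Filter.Product

/-! Let θ = #Θ and let W have order type θ⁺. Under extension, the injective sequences form a tree
that is not a union of θ antichains (`not_special_univ`). An Ulam matrix yields κ disjoint sets S_γ
of lengths such that the part of the tree with lengths in S_γ is not such a union either
(`exists_disjoint_not_special`). B_γ is generated by elements x_f for f in that part, with x_f ∧ x_g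
= 0 as the only relations, for comparable f ≠ g. A cover of B_γ \ {0} by θ linked sets would colour
that part of the tree by antichains, so d₂ > θ.

For the upper bounds, every nonzero element is above a condition on finitely many sequences (a
`Datum`). Recording the entries at which these sequences split pairwise takes θ^ℵ₀ = θ codes. Two
data with the same code clash only if, at some common index, a sequence of one properly extends that
of the other (`exists_isInit_of_not_compat`). In B_γ, recording the lengths too excludes this, at
the price of θ⁺ colours. In the ultraproduct, one records instead the entries of the sequences of
each coordinate at the lengths from all coordinates, with θ^κ = θ colours. Elements of the same
colour then clash in at most one coordinate, which a non-principal ultrafilter ignores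
(`topDensity_product_le`). -/

/-! ### Injective sequences and where two of them split. -/

/-- An injective sequence of elements of `Θ`, indexed by a proper initial segment of `W`. -/
@[ext]
structure InjSeq (W Θ : Type u) [LinearOrder W] where
  /-- the length of the sequence -/
  len : W
  /-- the entries, `none` from `len` on -/
  val : W → Option Θ
  val_eq_none_iff : ∀ x, val x = none ↔ len ≤ x
  inj : ∀ x y v, val x = some v → val y = some v → x = y

namespace InjSeq

variable {W Θ : Type u} [LinearOrder W]

/-- `f` is a proper initial segment of `g`. -/
def IsInit (f g : InjSeq W Θ) : Prop :=
  f.len < g.len ∧ ∀ x < f.len, f.val x = g.val x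

theorem lt_len_of_val_eq_some {f : InjSeq W Θ} {x : W} {v : Θ} (h : f.val x = some v) :
    x < f.len := by
  by_contra hx
  rw [(f.val_eq_none_iff x).2 (not_lt.1 hx)] at h
  cases h

theorem exists_val_eq_some {f : InjSeq W Θ} {x : W} (h : x < f.len) : ∃ v, f.val x = some v :=
  Option.ne_none_iff_exists'.1 fun h' => h.not_ge ((f.val_eq_none_iff x).1 h')

theorem eq_of_val_eq {f : InjSeq W Θ} {x y : W} (h : f.val x = f.val y) (hx : f.val x ≠ none) :
    x = y := by
  obtain ⟨v, hv⟩ := Option.ne_none_iff_exists'.1 hx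
  exact f.inj x y v hv (h ▸ hv)

theorem ext_val {f g : InjSeq W Θ} (h : f.val = g.val) : f = g := by
  refine InjSeq.ext ?_ h
  have key : ∀ x, f.len ≤ x ↔ g.len ≤ x := fun x => by
    rw [← f.val_eq_none_iff, ← g.val_eq_none_iff, h]
  exact le_antisymm ((key _).2 le_rfl) ((key _).1 le_rfl)

theorem IsInit.val_eq {f g : InjSeq W Θ} (h : f.IsInit g) {x : W} {v : Θ}
    (hx : f.val x = some v) : g.val x = some v := by
  rw [← h.2 x (lt_len_of_val_eq_some hx), hx]

/-- Equal entries of two comparable sequences occur at the same index. -/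
theorem index_eq {f g : InjSeq W Θ} (h : f.IsInit g ∨ g.IsInit f) {x y : W} {v : Θ}
    (hx : f.val x = some v) (hy : g.val y = some v) : x = y := by
  rcases h with h | h
  · exact g.inj x y v (h.val_eq hx) hy
  · exact f.inj x y v hx (h.val_eq hy)

open Classical in
/-- The entries of two sequences at the first index at which they differ. -/
noncomputable def sep [WellFoundedLT W] (f g : InjSeq W Θ) : Option Θ × Option Θ :=
  if h : {x | f.val x ≠ g.val x}.Nonempty then
    let x := wellFounded_lt.min {x | f.val x ≠ g.val x} h
    (f.val x, g.val x)
  else (none, none)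

theorem exists_sep [WellFoundedLT W] {f g : InjSeq W Θ} (h : f ≠ g) :
    ∃ x, (∀ y < x, f.val y = g.val y) ∧ f.val x ≠ g.val x ∧ sep f g = (f.val x, g.val x) := by
  have hne : {x | f.val x ≠ g.val x}.Nonempty := by
    by_contra hemp
    exact h (ext_val (funext fun x => by_contra fun hx => hemp ⟨x, hx⟩))
  refine ⟨wellFounded_lt.min {x | f.val x ≠ g.val x} hne, fun y hy => ?_,
    wellFounded_lt.min_mem _ hne, by rw [sep, dif_pos hne]⟩
  by_contra hy'
  exact wellFounded_lt.not_lt_min {x | f.val x ≠ g.val x} hy' hy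

theorem sep_swap [WellFoundedLT W] (f g : InjSeq W Θ) : sep g f = (sep f g).swap := by
  rcases eq_or_ne f g with rfl | h
  · simp [sep]
  obtain ⟨x, h1, h2, h3⟩ := exists_sep h
  obtain ⟨y, h4, h5, h6⟩ := exists_sep h.symm
  obtain rfl : x = y := by
    rcases lt_trichotomy x y with hxy | hxy | hxy
    · exact absurd (h4 x hxy).symm h2
    · exact hxy
    · exact absurd (h1 y hxy).symm h5
  rw [h3, h6, Prod.swap]

/-- A sequence that has already ended at the first difference is an initial segment of the other. -/
theorem sep_ne_none [WellFoundedLT W] {f g : InjSeq W Θ} (h : f ≠ g) (h1 : ¬ f.IsInit g)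
    (h2 : ¬ g.IsInit f) : (sep f g).1 ≠ none ∧ (sep f g).2 ≠ none := by
  obtain ⟨x, hx, hne, he⟩ := exists_sep h
  rw [he]
  constructor
  · intro hf
    have hfx := (f.val_eq_none_iff x).1 hf
    obtain ⟨v, hv⟩ := Option.ne_none_iff_exists'.1 (fun h' => hne (hf.trans h'.symm))
    exact h1 ⟨hfx.trans_lt (lt_len_of_val_eq_some hv), fun y hy => hx y (hy.trans_le hfx)⟩
  · intro hg
    have hgx := (g.val_eq_none_iff x).1 hg
    obtain ⟨v, hv⟩ := Option.ne_none_iff_exists'.1 (fun h' => hne (h'.trans hg.symm))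
    exact h2 ⟨hgx.trans_lt (lt_len_of_val_eq_some hv), fun y hy => (hx y (hy.trans_le hgx)).symm⟩

/-- The heart of the separation argument: the values of `sep` tell the two members of a pair apart
even in another pair with the same values. -/
theorem ne_of_sep_eq [WellFoundedLT W] {f₁ f₂ g₁ g₂ : InjSeq W Θ} (hf : f₁ ≠ f₂) (hg : g₁ ≠ g₂)
    (h : sep f₁ f₂ = sep g₁ g₂) : f₁ ≠ g₂ := by
  rintro rfl
  obtain ⟨x, hx, hxne, hxe⟩ := exists_sep hf
  obtain ⟨y, hy, hyne, hye⟩ := exists_sep hg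
  rw [hxe, hye, Prod.mk.injEq] at h
  obtain ⟨ha, hb⟩ := h
  -- If the splitting indices differ, one of `g₁`, `f₂` takes the same value at both, against
  -- injectivity. The value `none` is treated apart, because it may repeat.
  rcases lt_trichotomy x y with hxy | rfl | hxy
  · have e : g₁.val x = g₁.val y := (hy x hxy).trans ha
    by_cases hn : g₁.val x = none
    · have h1 : f₁.val x = none := by rw [← hy x hxy, hn]
      have h2 : f₁.val y = none := (f₁.val_eq_none_iff y).2
        (((f₁.val_eq_none_iff x).1 h1).trans hxy.le)
      exact hyne (by rw [← e, hn, h2])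
    · exact hxy.ne (eq_of_val_eq e hn)
  · exact hyne ha.symm
  · have e : f₂.val y = f₂.val x := by rw [← hx y hxy, hb]
    by_cases hn : f₂.val y = none
    · have h1 : f₁.val y = none := by rw [hx y hxy, hn]
      have h2 : f₁.val x = none := (f₁.val_eq_none_iff x).2
        (((f₁.val_eq_none_iff y).1 h1).trans hxy.le)
      exact hxne (by rw [h2, ← e, hn])
    · exact hxy.ne (eq_of_val_eq e hn)

/-- The splitting indices are compared as in `ne_of_sep_eq`. Since the entries are not `none`, the
index `x` is below the length of `f₁`, where `f₁` and `g₂` would agree. -/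
theorem not_isInit_of_sep_eq [WellFoundedLT W] {f₁ f₂ g₁ g₂ : InjSeq W Θ} (hf : f₁ ≠ f₂)
    (hg : g₁ ≠ g₂) (h : sep f₁ f₂ = sep g₁ g₂) (h1 : (sep f₁ f₂).1 ≠ none)
    (h2 : (sep f₁ f₂).2 ≠ none) : ¬ f₁.IsInit g₂ := by
  intro hi
  obtain ⟨x, hx, hxne, hxe⟩ := exists_sep hf
  obtain ⟨y, hy, hyne, hye⟩ := exists_sep hg
  rw [hxe] at h1 h2
  rw [hxe, hye, Prod.mk.injEq] at h
  obtain ⟨ha, hb⟩ := h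
  obtain ⟨a, hfa⟩ := Option.ne_none_iff_exists'.1 h1
  have hxl := lt_len_of_val_eq_some hfa
  have hgx : g₂.val x = f₁.val x := (hi.2 x hxl).symm
  rcases lt_trichotomy x y with hxy | rfl | hxy
  · have e : g₁.val x = g₁.val y := by rw [hy x hxy, hgx, ha]
    exact hxy.ne (eq_of_val_eq e (by rw [e, ← ha]; exact h1))
  · exact hyne (by rw [← ha, hgx])
  · have e : f₂.val x = f₂.val y := by rw [hb, ← hx y hxy, hi.2 y (hxy.trans hxl)]
    exact hxy.ne' (eq_of_val_eq e h2)

/-- In sets of pairwise incomparable sequences, `sep` excludes comparability across indices. -/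
theorem not_comparable_of_sep_eq [WellFoundedLT W] {f₁ f₂ g₁ g₂ : InjSeq W Θ} (hf : f₁ ≠ f₂)
    (hg : g₁ ≠ g₂) (h : sep f₁ f₂ = sep g₁ g₂) (h1 : ¬ f₁.IsInit f₂) (h2 : ¬ f₂.IsInit f₁) :
    ¬ (f₁.IsInit g₂ ∨ g₂.IsInit f₁) := by
  have hn := sep_ne_none hf h1 h2
  rintro (hi | hi)
  · exact not_isInit_of_sep_eq hf hg h hn.1 hn.2 hi
  · refine not_isInit_of_sep_eq hg.symm hf.symm ?_ ?_ ?_ hi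
    · rw [sep_swap g₁, sep_swap f₁, h]
    · rw [sep_swap g₁, ← h]; exact hn.2
    · rw [sep_swap g₁, ← h]; exact hn.1

/-! ### The ideal of special sets of lengths. -/

/-- The restriction of an injective function to a proper initial segment. -/
def ofFun (F : W → Θ) (γ : W) (hF : Set.InjOn F (Set.Iio γ)) : InjSeq W Θ where
  len := γ
  val x := if x < γ then some (F x) else none
  val_eq_none_iff x := by simp
  inj x y v hx hy := by
    simp only [Option.ite_none_right_eq_some, Option.some.injEq] at hx hy
    exact hF hx.1 hy.1 (hx.2.trans hy.2.symm)

/-- `S` is special if the sequences with length in `S` are a union of `#Θ` antichains. -/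
def Special (Θ : Type u) (S : Set W) : Prop :=
  ∃ c : InjSeq W Θ → Θ, ∀ f g : InjSeq W Θ, f.len ∈ S → g.len ∈ S → f.IsInit g → c f ≠ c g

/-- Given a colouring `c`, the recursion G(x) = c(G restricted to x) would produce an injection of
`W` into `Θ`, because the restrictions of G are pairwise comparable. -/
theorem not_special_univ [WellFoundedLT W] (hW : #Θ < #W) :
    ¬ Special Θ (Set.univ : Set W) := by
  classical
  rintro ⟨c, hc⟩
  have hΘ : Nonempty Θ := by
    by_contra hemp
    rw [not_nonempty_iff] at hemp
    have hW' : Nonempty W := by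
      rw [← mk_ne_zero_iff]
      exact (pos_of_gt hW).ne'
    obtain ⟨w⟩ := hW'
    let m := wellFounded_lt.min (Set.univ : Set W) ⟨w, trivial⟩
    exact hemp.elim (c ⟨m, fun _ => none, fun x => by
      simpa using not_lt.1 (wellFounded_lt.not_lt_min Set.univ (Set.mem_univ x)), by simp⟩)
  obtain ⟨θ₀⟩ := hΘ
  -- The default `θ₀` serves restrictions that are not injective; `hinj` shows that none occur.
  let step : (x : W) → ((y : W) → y < x → Θ) → Θ := fun x G =>
    if h : Set.InjOn (fun y => if hy : y < x then G y hy else θ₀) (Set.Iio x) then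
      c (ofFun _ x h) else θ₀
  let G : W → Θ := wellFounded_lt.fix step
  have hG : ∀ x, ∀ h : Set.InjOn G (Set.Iio x), G x = c (ofFun G x h) := by
    intro x h
    have h0 : Set.EqOn G (fun y => if hy : y < x then G y else θ₀) (Set.Iio x) := by
      intro y (hy : y < x)
      simp [hy]
    have h1 : Set.InjOn (fun y => if hy : y < x then G y else θ₀) (Set.Iio x) := h.congr h0
    have h2 : G x = step x fun y _ => G y := wellFounded_lt.fix_eq step x
    rw [h2]
    simp only [step]
    rw [dif_pos h1]
    congr 1
    refine ext_val (funext fun y => ?_)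
    by_cases hy : y < x <;> simp [ofFun, hy]
  have hinj : ∀ x, Set.InjOn G (Set.Iio x) := by
    intro x
    induction x using WellFoundedLT.induction with
    | _ x ih =>
      have key : ∀ y z, y < z → z < x → G y ≠ G z := by
        intro y z hyz hzx
        rw [hG y (ih y (hyz.trans hzx)), hG z (ih z hzx)]
        refine hc _ _ trivial trivial ⟨hyz, fun w hw => ?_⟩
        have hw' : w < y := hw
        simp [ofFun, hw', hw'.trans hyz]
      intro y (hy : y < x) z (hz : z < x) h
      rcases lt_trichotomy y z with hyz | hyz | hyz
      · exact absurd h (key y z hyz hz)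
      · exact hyz
      · exact absurd h.symm (key z y hyz hy)
  have hinj' : Function.Injective G := by
    have key : ∀ y z, y < z → G y ≠ G z := by
      intro y z hyz
      rw [hG y (hinj y), hG z (hinj z)]
      refine hc _ _ trivial trivial ⟨hyz, fun w hw => ?_⟩
      have hw' : w < y := hw
      simp [ofFun, hw', hw'.trans hyz]
    intro y z h
    rcases lt_trichotomy y z with hyz | hyz | hyz
    · exact absurd h (key y z hyz)
    · exact hyz
    · exact absurd h.symm (key z y hyz)
  exact hW.not_ge (mk_le_of_injective hinj')

theorem Special.mono {S S' : Set W} (h : Special Θ S') (hS : S ⊆ S') : Special Θ S := by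
  obtain ⟨c, hc⟩ := h
  exact ⟨c, fun f g hf hg => hc f g (hS hf) (hS hg)⟩

theorem special_of_coloring {C : Type u} (hC : #C ≤ #Θ) {S : Set W} (c : InjSeq W Θ → C)
    (hc : ∀ f g : InjSeq W Θ, f.len ∈ S → g.len ∈ S → f.IsInit g → c f ≠ c g) :
    Special Θ S := by
  obtain ⟨e⟩ := hC
  exact ⟨fun f => e (c f), fun f g hf hg h => e.injective.ne (hc f g hf hg h)⟩

variable [Infinite Θ]

/-- Colour a sequence by a chosen index `i` whose `S i` contains its length, paired with its colour
for `S i`. -/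
theorem special_iUnion {I : Type u} (hI : #I ≤ #Θ) (S : I → Set W) (h : ∀ i, Special Θ (S i)) :
    Special Θ (⋃ i, S i) := by
  classical
  choose c hc using h
  rcases isEmpty_or_nonempty I with hI' | ⟨⟨i₀⟩⟩
  · simp only [Set.iUnion_of_empty]
    exact ⟨fun _ => Classical.arbitrary Θ, by simp⟩
  let k : InjSeq W Θ → I := fun f =>
    if h : ∃ i, f.len ∈ S i then h.choose else i₀
  have hk : ∀ f : InjSeq W Θ, f.len ∈ ⋃ i, S i → f.len ∈ S (k f) := by
    intro f hf
    have hf' : ∃ i, f.len ∈ S i := by simpa using hf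
    simp only [k, dif_pos hf']
    exact hf'.choose_spec
  refine special_of_coloring (C := I × Θ) ?_ (fun f => (k f, c (k f) f)) ?_
  · rw [mk_prod, lift_id, lift_id]
    exact (mul_le_mul_left hI _).trans (mul_eq_self (aleph0_le_mk Θ)).le
  · intro f g hf hg hfg h
    rw [Prod.mk.injEq] at h
    have hf' := hk f hf
    have hg' := hk g hg
    rw [← h.1] at hg'
    refine hc _ f g hf' hg' hfg ?_
    have := h.2
    rwa [← h.1] at this

/-- Sequences of equal length are incomparable, so singletons are special. -/
theorem special_of_mk_le {S : Set W} (h : #S ≤ #Θ) : Special Θ S := by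
  have : S = ⋃ x : S, {(x : W)} := by simp
  rw [this]
  refine special_iUnion h _ fun x => ⟨fun _ => Classical.arbitrary Θ, fun f g hf hg hfg => ?_⟩
  have h1 : f.len = x := hf
  have h2 : g.len = x := hg
  exact absurd (h1.trans h2.symm) hfg.1.ne

/-- There are more than `#Θ` pairwise disjoint sets that are not special: the Ulam matrix. -/
theorem exists_disjoint_not_special [WellFoundedLT W] (hW : #Θ < #W)
    (hseg : ∀ x : W, #(Set.Iic x) ≤ #Θ) (ι : Type u) (hι : #ι ≤ #Θ) :
    ∃ S : ι → Set W, (∀ i, ¬ Special Θ (S i)) ∧ Pairwise fun i j => Disjoint (S i) (S j) := by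
  have he : ∀ x : W, ∃ e : W → Θ, Set.InjOn e (Set.Iic x) := by
    intro x
    obtain ⟨e⟩ := hseg x
    classical
    refine ⟨fun y => if h : y ∈ Set.Iic x then e ⟨y, h⟩ else Classical.arbitrary Θ, ?_⟩
    intro y hy z hz h
    simp only [dif_pos hy, dif_pos hz] at h
    simpa using e.injective h
  choose e he using he
  -- In a column (fixed `ξ`) the sets cover everything above `ξ`, so one of them is not special. In
  -- a row (fixed `i`) they are disjoint, since `e γ` is injective. By pigeonhole some row has more
  -- than `#Θ` non-special sets.
  let A : Θ → W → Set W := fun i ξ => {γ | ξ < γ ∧ e γ ξ = i}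
  have hpos : ∀ ξ, ∃ i, ¬ Special Θ (A i ξ) := by
    intro ξ
    by_contra! hcon
    apply not_special_univ (Θ := Θ) hW
    have h1 := special_iUnion (le_refl #Θ) (fun i => A i ξ) hcon
    have h2 : Special Θ (Set.Iic ξ) := special_of_mk_le (hseg ξ)
    have h3 := special_iUnion (Θ := Θ) (I := ULift Bool) (by
      rw [mk_fintype]
      exact (natCast_lt_aleph0.le).trans (aleph0_le_mk Θ))
      (fun b : ULift Bool => if b.down then ⋃ i, A i ξ else Set.Iic ξ) (by
        rintro ⟨_ | _⟩
        · simpa using h2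
        · simpa using h1)
    refine h3.mono fun γ _ => Set.mem_iUnion.2 ?_
    rcases lt_or_ge ξ γ with h | h
    · exact ⟨⟨true⟩, by simpa [A] using h⟩
    · exact ⟨⟨false⟩, by simpa using h⟩
  choose k hk using hpos
  have hbig : ∃ i, #Θ < #(k ⁻¹' {i}) := by
    by_contra! hcon
    apply hW.not_ge
    have : (Set.univ : Set W) = ⋃ i, k ⁻¹' {i} := by ext; simp
    rw [← mk_univ, this]
    refine (mk_iUnion_le _).trans ?_
    refine (mul_le_mul_right (ciSup_le' hcon) _).trans (mul_eq_self (aleph0_le_mk Θ)).le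
  obtain ⟨i, hi⟩ := hbig
  obtain ⟨E⟩ := hι.trans hi.le
  refine ⟨fun j => A i (E j), fun j => ?_, fun j j' hj => ?_⟩
  · have h : k (E j) = i := (E j).2
    have h' := hk (E j : W)
    rw [h] at h'
    exact h'
  · refine Set.disjoint_left.2 fun γ h1 h2 => hj ?_
    refine E.injective (Subtype.ext ?_)
    exact he γ (Set.mem_Iic.2 h1.1.le) (Set.mem_Iic.2 h2.1.le) (h1.2.trans h2.2.symm)

end InjSeq

/-! ### Density bounds in terms of colourings. -/

theorem topDensity_le_of_centered {B C : Type u} [BooleanAlgebra B] (c : B → C)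
    (hc : ∀ (x : C) (s : Finset B), (∀ b ∈ s, b ≠ ⊥ ∧ c b = x) → s.inf id ≠ ⊥) :
    topDensity B ≤ #C := by
  choose F hF using fun x : C => UltSpace.exists_of_centered {b : B | b ≠ ⊥ ∧ c b = x}
    fun s hs => hc x s fun b hb => hs hb
  refine le_trans (csInf_le' ⟨Set.range F, ?_, rfl⟩) mk_range_le
  rw [UltSpace.dense_iff]
  exact fun b hb => ⟨F (c b), ⟨c b, rfl⟩, hF (c b) b ⟨hb, rfl⟩⟩

theorem densitySentence_self {B : Type u} [BooleanAlgebra B] (k : ℕ) :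
    densitySentence {x : B | x ≠ ⊥} (fun y x => x ≠ ⊥ ∧ x = y) k := by
  rcases k with _ | k
  · exact ⟨fun x hx => ⟨x, hx, hx, rfl⟩, fun x y _ h => h.1⟩
  · intro x y hy h h0
    apply hy
    rw [← le_bot_iff, ← h0]
    exact Finset.le_inf fun i _ => (h i).2.ge

theorem finDensity_le_topDensity (n : ℕ∞) (B : Type u) [BooleanAlgebra B] :
    finDensity n B ≤ topDensity B := by
  rw [topDensity_eq_finDensity]
  refine le_csInf ⟨_, _, _, fun k _ => densitySentence_self k, rfl⟩ ?_
  rintro _ ⟨P₀, P₁, hP, rfl⟩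
  exact csInf_le' ⟨P₀, P₁, fun k hk => hP k (hk.trans_le le_top), rfl⟩

theorem le_finDensity_two {B : Type u} [BooleanAlgebra B] [Nontrivial B] {μ : Cardinal.{u}}
    (h : ∀ (C : Type u) (c : B → C),
      (∀ x y : B, x ≠ ⊥ → y ≠ ⊥ → c x = c y → x ⊓ y ≠ ⊥) → μ ≤ #C) :
    μ ≤ finDensity 2 B := by
  refine le_csInf ⟨_, _, _, fun k _ => densitySentence_self k, rfl⟩ ?_
  rintro _ ⟨P₀, P₁, hP, rfl⟩
  have h0 := (hP 0 (by norm_num)).1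
  have h1 := hP 1 (by norm_num)
  have ht : ∀ x : B, ∃ y : P₀, x ≠ ⊥ → P₁ y x := by
    intro x
    by_cases hx : x = ⊥
    -- The colour of `⊥` is irrelevant, but `P₀` must supply one.
    · obtain ⟨y, hy, -⟩ := h0 ⊤ top_ne_bot
      exact ⟨⟨y, hy⟩, fun h => absurd hx h⟩
    · obtain ⟨y, hy, hyx⟩ := h0 x hx
      exact ⟨⟨y, hy⟩, fun _ => hyx⟩
  choose c hc using ht
  refine h P₀ c fun x y hx hy hxy => ?_
  have := h1 ![x, y] (c x) (c x).2 (by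
    intro i
    fin_cases i
    · exact hc x hx
    · rw [hxy]; exact hc y hy)
  simpa [Fin.univ_succ] using this

/-! ### The algebras and their finite conditions. -/

namespace InjSeq

variable {W Θ : Type u} [LinearOrder W]

/-- The sets of pairwise incomparable sequences with lengths in `S`. -/
def Incomp (Θ : Type u) (S : Set W) : Type u :=
  {a : Set (InjSeq W Θ) // (∀ f ∈ a, f.len ∈ S) ∧ ∀ f ∈ a, ∀ g ∈ a, ¬ f.IsInit g}

/-- The algebra of the sets of members of `Incomp Θ S` that depend on finitely many sequences. -/
def incompAlg (Θ : Type u) (S : Set W) : BooleanSubalgebra (Set (Incomp Θ S)) where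
  carrier := {b | ∃ H : Finset (InjSeq W Θ), ∀ a a' : Incomp Θ S,
    (∀ f ∈ H, f ∈ a.1 ↔ f ∈ a'.1) → (a ∈ b ↔ a' ∈ b)}
  supClosed' := by
    classical
    rintro b ⟨H, hH⟩ b' ⟨H', hH'⟩
    exact ⟨H ∪ H', fun a a' h => or_congr
      (hH a a' fun f hf => h f (Finset.mem_union_left _ hf))
      (hH' a a' fun f hf => h f (Finset.mem_union_right _ hf))⟩
  infClosed' := by
    classical
    rintro b ⟨H, hH⟩ b' ⟨H', hH'⟩
    exact ⟨H ∪ H', fun a a' h => and_congr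
      (hH a a' fun f hf => h f (Finset.mem_union_left _ hf))
      (hH' a a' fun f hf => h f (Finset.mem_union_right _ hf))⟩
  compl_mem' := by
    rintro b ⟨H, hH⟩
    exact ⟨H, fun a a' h => not_congr (hH a a' h)⟩
  bot_mem' := ⟨∅, fun _ _ _ => Iff.rfl⟩

/-- The generator of the algebra that corresponds to a sequence. -/
def gen (S : Set W) (f : InjSeq W Θ) : incompAlg Θ S :=
  ⟨{a | f ∈ a.1}, {f}, fun a a' h => h f (by simp)⟩

/-- The member `{f}` of `Incomp Θ S`. -/
def singletonIncomp {S : Set W} (f : InjSeq W Θ) (hf : f.len ∈ S) : Incomp Θ S :=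
  ⟨{f}, by rintro _ rfl; exact hf, by rintro _ rfl _ rfl h; exact h.1.ne rfl⟩

theorem gen_ne_bot {S : Set W} (f : InjSeq W Θ) (hf : f.len ∈ S) : gen S f ≠ ⊥ := by
  intro h
  have h' : (singletonIncomp f hf) ∈ ((gen S f : incompAlg Θ S) : Set (Incomp Θ S)) :=
    Set.mem_singleton f
  rw [h] at h'
  exact h'

theorem gen_injOn (S : Set W) : Set.InjOn (gen S) {f : InjSeq W Θ | f.len ∈ S} := by
  intro f hf g hg h
  have h' : (singletonIncomp f hf) ∈ ((gen S f : incompAlg Θ S) : Set (Incomp Θ S)) :=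
    Set.mem_singleton f
  rw [h] at h'
  exact (Set.mem_singleton_iff.1 h').symm

theorem gen_inf_gen {S : Set W} {f g : InjSeq W Θ} (h : f.IsInit g) :
    gen S f ⊓ gen S g = ⊥ := by
  refine Subtype.ext (Set.eq_empty_of_forall_notMem ?_)
  rintro a ⟨hf, hg⟩
  exact a.2.2 f hf g hg h

/-- A finite list of distinct sequences, some of them marked; the marked ones are pairwise
incomparable and have lengths in `S`. -/
structure Datum (Θ : Type u) (S : Set W) where
  /-- the number of sequences -/
  n : ℕ
  /-- the sequences -/
  seq : ℕ → InjSeq W Θ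
  /-- the marks -/
  mark : ℕ → Bool
  inj : ∀ i < n, ∀ j < n, seq i = seq j → i = j
  len_mem : ∀ i < n, mark i = true → (seq i).len ∈ S
  incomp : ∀ i < n, ∀ j < n, mark i = true → mark j = true → ¬ (seq i).IsInit (seq j)

namespace Datum

variable {S : Set W}

/-- `a` contains exactly the marked sequences of `d`. -/
def Meets (d : Datum Θ S) (a : Incomp Θ S) : Prop :=
  ∀ i < d.n, d.seq i ∈ a.1 ↔ d.mark i = true

/-- Pick a member of `b` and mark the sequences of a finite support of `b` that it contains. -/
theorem exists_meets_subset [Nonempty (InjSeq W Θ)] {b : incompAlg Θ S} (hb : b ≠ ⊥) :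
    ∃ d : Datum Θ S, ∀ a, d.Meets a → a ∈ b.1 := by
  classical
  obtain ⟨b, H, hH⟩ := b
  obtain ⟨a, ha⟩ : b.Nonempty := by
    rw [Set.nonempty_iff_ne_empty]
    rintro rfl
    exact hb rfl
  have hseq : ∃ seq : ℕ → InjSeq W Θ, (∀ i < H.card, ∀ j < H.card, seq i = seq j → i = j) ∧
      ∀ f ∈ H, ∃ i < H.card, seq i = f := by
    refine ⟨fun i => if h : i < H.card then H.equivFin.symm ⟨i, h⟩ else Classical.arbitrary _,
      ?_, ?_⟩
    · intro i hi j hj h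
      simpa [hi, hj, Subtype.val_inj] using h
    · intro f hf
      exact ⟨H.equivFin ⟨f, hf⟩, Fin.is_lt _, by simp⟩
  obtain ⟨seq, hinj, hsurj⟩ := hseq
  refine ⟨⟨H.card, seq, fun i => decide (seq i ∈ a.1), hinj, ?_, ?_⟩, ?_⟩
  · intro i _ h
    exact a.2.1 _ (of_decide_eq_true h)
  · intro i _ j _ h h'
    exact a.2.2 _ (of_decide_eq_true h) _ (of_decide_eq_true h')
  · intro a' ha'
    refine (hH a' a fun f hf => ?_).2 ha
    obtain ⟨i, hi, rfl⟩ := hsurj f hf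
    exact (ha' i hi).trans (decide_eq_true_iff)

/-- Half of what it takes for the conditions that two data impose to be consistent. -/
def Compat (d d' : Datum Θ S) : Prop :=
  ∀ i < d.n, d.mark i = true → ∀ j < d'.n,
    (d.seq i = d'.seq j → d'.mark j = true) ∧
      (d'.mark j = true → ¬ (d.seq i).IsInit (d'.seq j))

/-- The set of all marked sequences is the witness: `Compat` makes it pairwise incomparable and
keeps unmarked sequences out. -/
theorem exists_forall_meets {K : Type*} (d : K → Datum Θ S) (h : ∀ k l, (d k).Compat (d l)) :
    ∃ a, ∀ k, (d k).Meets a := by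
  refine ⟨⟨{f | ∃ k, ∃ i < (d k).n, (d k).mark i = true ∧ (d k).seq i = f}, ?_, ?_⟩, ?_⟩
  · rintro _ ⟨k, i, hi, hm, rfl⟩
    exact (d k).len_mem i hi hm
  · rintro _ ⟨k, i, hi, hm, rfl⟩ _ ⟨l, j, hj, hm', rfl⟩
    exact (h k l i hi hm j hj).2 hm'
  · intro l j hj
    constructor
    · rintro ⟨k, i, hi, hm, he⟩
      exact (h k l i hi hm j hj).1 he
    · exact fun hm => ⟨l, j, hj, hm, rfl⟩

theorem inf_ne_bot (s : Finset (incompAlg Θ S)) (d : incompAlg Θ S → Datum Θ S)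
    (hd : ∀ b ∈ s, ∀ a, (d b).Meets a → a ∈ b.1)
    (h : ∀ b ∈ s, ∀ b' ∈ s, (d b).Compat (d b')) : s.inf id ≠ ⊥ := by
  classical
  obtain ⟨a, ha⟩ := exists_forall_meets (fun b : s => d b) fun b b' => h b b.2 b' b'.2
  have key : ∀ t ⊆ s, a ∈ (t.inf id).1 := by
    intro t
    induction t using Finset.induction_on with
    | empty => exact fun _ => Set.mem_univ a
    | insert b t _ ih =>
      intro ht
      rw [Finset.inf_insert]
      exact ⟨hd b (ht (Finset.mem_insert_self b t)) a (ha ⟨b, ht (Finset.mem_insert_self b t)⟩),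
        ih ((Finset.subset_insert b t).trans ht)⟩
  intro h0
  have := key s subset_rfl
  rw [h0] at this
  exact this

variable [WellFoundedLT W]

/-- The invariant of a datum that makes two data with the same value almost compatible. -/
noncomputable def code (d : Datum Θ S) (p : ℕ × ℕ) : ℕ × Bool × Option Θ × Option Θ :=
  (d.n, d.mark p.1, sep (d.seq p.1) (d.seq p.2))

/-- Across different indices, equal values of `sep` exclude both equality and, for marked sequences,
comparability. At one index the marks agree, so only a proper extension can violate `Compat`. -/
theorem exists_isInit_of_not_compat {d d' : Datum Θ S} (h : d.code = d'.code)
    (hn : ¬ d.Compat d') :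
    ∃ i < d.n, d.mark i = true ∧ d'.mark i = true ∧ (d.seq i).IsInit (d'.seq i) := by
  have hc : ∀ i j, d.n = d'.n ∧ d.mark i = d'.mark i ∧
      sep (d.seq i) (d.seq j) = sep (d'.seq i) (d'.seq j) := fun i j => by
    simpa [code] using congrFun h (i, j)
  have hnn : d.n = d'.n := (hc 0 0).1
  unfold Compat at hn
  push Not at hn
  obtain ⟨i, hi, hm, j, hj, hij⟩ := hn
  rcases eq_or_ne i j with rfl | hne
  · have hm' : d'.mark i = true := (hc i i).2.1 ▸ hm
    exact ⟨i, hi, hm, hm', (hij fun _ => hm').2⟩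
  have h1 : d.seq i ≠ d.seq j := fun he => hne (d.inj i hi j (hnn ▸ hj) he)
  have h2 : d'.seq i ≠ d'.seq j := fun he => hne (d'.inj i (hnn ▸ hi) j hj he)
  have hs := (hc i j).2.2
  obtain ⟨hm', hin⟩ := hij fun he => absurd he (ne_of_sep_eq h1 h2 hs)
  have hmj : d.mark j = true := (hc j j).2.1.trans hm'
  exact absurd (Or.inl hin) (not_comparable_of_sep_eq h1 h2 hs
    (d.incomp i hi j (hnn ▸ hj) hm hmj) (d.incomp j (hnn ▸ hj) i hi hmj hm))

end Datum

end InjSeq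

/-! ### Densities of the algebras and of their ultraproducts. -/

namespace InjSeq

variable {W Θ : Type u} [LinearOrder W] [WellFoundedLT W] [Infinite Θ]

theorem mk_code_values : #(ULift.{u} ℕ × ULift.{u} Bool × Option Θ × Option Θ) = #Θ := by
  have h1 : #(Option Θ) = #Θ := by
    rw [mk_option, add_one_eq (aleph0_le_mk Θ)]
  have h2 : #(ULift.{u} Bool) ≤ #Θ := by
    rw [mk_fintype]
    exact natCast_lt_aleph0.le.trans (aleph0_le_mk Θ)
  have h3 : #(ULift.{u} ℕ) ≤ #Θ := by simp
  have h4 : #(Option Θ × Option Θ) = #Θ := by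
    rw [← mul_def, h1, mul_eq_self (aleph0_le_mk Θ)]
  have h5 : #(ULift.{u} Bool × Option Θ × Option Θ) = #Θ := by
    rw [mk_prod, lift_id, lift_id, h4, mul_eq_right (aleph0_le_mk Θ) h2 (mk_ne_zero _)]
  rw [mk_prod, lift_id, lift_id, h5, mul_eq_right (aleph0_le_mk Θ) h3 (mk_ne_zero _)]

omit [WellFoundedLT W] [Infinite Θ] in
theorem succ_le_finDensity_two {S : Set W} [Nonempty Θ] (hS : ¬ Special Θ S) :
    succ #Θ ≤ finDensity 2 (incompAlg Θ S) := by
  have hne : ∃ f : InjSeq W Θ, f.len ∈ S := by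
    by_contra! hcon
    exact hS ⟨fun _ => Classical.arbitrary Θ, fun f _ hf => absurd hf (hcon f)⟩
  obtain ⟨f₀, hf₀⟩ := hne
  have hnt : Nontrivial (incompAlg Θ S) := ⟨_, _, gen_ne_bot f₀ hf₀⟩
  refine le_finDensity_two fun C c hc => ?_
  rw [succ_le_iff]
  by_contra! hC
  refine hS (special_of_coloring hC (fun f => c (gen S f)) fun f g hf hg hfg h => ?_)
  exact hc _ _ (gen_ne_bot f hf) (gen_ne_bot g hg) h (gen_inf_gen hfg)

omit [WellFoundedLT W] [Infinite Θ] in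
/-- A datum below a given nonzero element. -/
theorem exists_datum_map (S : Set W) [Nonempty (InjSeq W Θ)] :
    ∃ d : incompAlg Θ S → Datum Θ S, ∀ b, b ≠ ⊥ → ∀ a, (d b).Meets a → a ∈ b.1 := by
  have h : ∀ b : incompAlg Θ S, ∃ d : Datum Θ S, b ≠ ⊥ → ∀ a, d.Meets a → a ∈ b.1 := by
    intro b
    by_cases hb : b = ⊥
    · exact ⟨⟨0, fun _ => Classical.arbitrary _, fun _ => false, by simp, by simp, by simp⟩,
        fun h => absurd hb h⟩
    · obtain ⟨d, hd⟩ := Datum.exists_meets_subset hb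
      exact ⟨d, fun _ => hd⟩
  choose d hd using h
  exact ⟨d, hd⟩

/-- The colour consists of the code and the list of lengths; equal lengths rule out the proper
extension that a clash requires. -/
theorem topDensity_incompAlg_le (S : Set W) [Nonempty (InjSeq W Θ)] (hW : #W = succ #Θ)
    (hpow : #Θ ^ ℵ₀ = #Θ) : topDensity (incompAlg Θ S) ≤ succ #Θ := by
  obtain ⟨d, hd⟩ := exists_datum_map (Θ := Θ) S
  let D := ULift.{u} ℕ × ULift.{u} Bool × Option Θ × Option Θ
  have hWi : Infinite W := by
    rw [infinite_iff, hW]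
    exact (aleph0_le_mk Θ).trans (le_succ _)
  let c : incompAlg Θ S → (ℕ × ℕ → D) × List W := fun b =>
    (fun p => (⟨(d b).n⟩, ⟨(d b).mark p.1⟩, sep ((d b).seq p.1) ((d b).seq p.2)),
      (List.range (d b).n).map fun i => ((d b).seq i).len)
  refine (topDensity_le_of_centered c ?_).trans ?_
  · intro x s hs
    refine Datum.inf_ne_bot s d (fun b hb => hd b (hs b hb).1) fun b hb b' hb' => ?_
    have h := (hs b hb).2.trans (hs b' hb').2.symm
    by_contra hn
    have h1 : (d b).code = (d b').code := by
      funext p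
      have := congrFun (congrArg Prod.fst h) p
      simp only [c, D, Prod.mk.injEq, ULift.up.injEq] at this
      simp only [Datum.code, this.1, this.2.1, this.2.2]
    obtain ⟨i, hi, -, -, hin⟩ := Datum.exists_isInit_of_not_compat h1 hn
    have hnn : (d b).n = (d b').n := congrArg Prod.fst (congrFun h1 (0, 0))
    have h2 := congrArg Prod.snd h
    simp only [c, ← hnn] at h2
    exact hin.1.ne (List.map_inj_left.1 h2 i (List.mem_range.2 hi))
  · rw [mk_prod, lift_id, lift_id, mk_list_eq_mk, hW, mk_arrow, mk_code_values]
    simp only [lift_uzero, mk_prod, mk_nat, lift_aleph0, aleph0_mul_aleph0, hpow]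
    rw [mul_eq_right ((aleph0_le_mk Θ).trans (le_succ _)) (le_succ _) (mk_ne_zero _)]

theorem finset_inf_product {ι : Type u} {D : Filter ι} {B : ι → Type u}
    [∀ i, BooleanAlgebra (B i)] (s : Finset (D.Product B)) :
    s.inf id = Quotient.mk'' fun i => s.inf fun x => Quotient.out x i := by
  classical
  induction s using Finset.induction_on with
  | empty => rfl
  | insert x s _ ih =>
    rw [Finset.inf_insert, ih]
    simp only [Finset.inf_insert]
    conv_lhs => rw [id, ← Quotient.out_eq x]
    rfl

theorem eventually_ne_bot {ι : Type u} {D : Ultrafilter ι} {B : ι → Type u}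
    [∀ i, BooleanAlgebra (B i)] {x : (D : Filter ι).Product B} (hx : x ≠ ⊥) :
    ∀ᶠ i in (D : Filter ι), Quotient.out x i ≠ ⊥ := by
  rw [Ultrafilter.eventually_not]
  intro h
  apply hx
  rw [← Quotient.out_eq x]
  exact Quotient.sound' h

theorem topDensity_product_le {ι : Type u} [Infinite ι] [Nonempty (InjSeq W Θ)]
    (hpow : #Θ ^ #ι = #Θ) (S : ι → Set W) (hS : Pairwise fun i j => Disjoint (S i) (S j))
    (D : Ultrafilter ι) (hD : ∀ i, D ≠ pure i) :
    topDensity ((D : Filter ι).Product fun i => incompAlg Θ (S i)) ≤ #Θ := by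
  classical
  choose d hd using fun ε => exists_datum_map (Θ := Θ) (S ε)
  let V := ULift.{u} ℕ × ULift.{u} Bool × Option Θ × Option Θ
  let c : (D : Filter ι).Product (fun i => incompAlg Θ (S i)) →
      (ι × ι × ℕ × ℕ → V × Option Θ) := fun x p =>
    let e := d p.1 (Quotient.out x p.1)
    let e' := d p.2.1 (Quotient.out x p.2.1)
    ((⟨e.n⟩, ⟨e.mark p.2.2.1⟩, sep (e.seq p.2.2.1) (e.seq p.2.2.2)),
      -- This entry lies in `Option Θ`, whereas the length itself would need `#W` colours.
      (e.seq p.2.2.1).val (e'.seq p.2.2.2).len)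
  refine (topDensity_le_of_centered c ?_).trans ?_
  · intro y s hs
    have hcompat : ∀ x ∈ s, ∀ x' ∈ s, ∀ᶠ i in (D : Filter ι),
        (d i (Quotient.out x i)).Compat (d i (Quotient.out x' i)) := by
      intro x hx x' hx'
      have h := (hs x hx).2.trans (hs x' hx').2.symm
      have hcode : ∀ i, (d i (Quotient.out x i)).code = (d i (Quotient.out x' i)).code := by
        intro i
        funext p
        have := congrArg Prod.fst (congrFun h (i, i, p.1, p.2))
        simp only [c, V, Prod.mk.injEq, ULift.up.injEq] at this
        simp only [Datum.code, this.1, this.2.1, this.2.2]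
      have hval : ∀ i j k l, ((d i (Quotient.out x i)).seq k).val
          ((d j (Quotient.out x j)).seq l).len = ((d i (Quotient.out x' i)).seq k).val
          ((d j (Quotient.out x' j)).seq l).len := fun i j k l =>
        congrArg Prod.snd (congrFun h (i, j, k, l))
      have hn : ∀ i, (d i (Quotient.out x i)).n = (d i (Quotient.out x' i)).n := fun i =>
        congrArg Prod.fst (congrFun (hcode i) (0, 0))
      change ∀ᶠ i in (D : Filter ι), _
      by_contra hcon
      rw [← Ultrafilter.eventually_not] at hcon
      -- The set of coordinates with a clash has at most one element, so it cannot belong to `D`.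
      refine absurd (Ultrafilter.eq_pure_of_finite_mem
        (Set.Subsingleton.finite ?_) hcon) fun ⟨i, _, hi⟩ => hD i hi
      intro i hi j hj
      by_contra hij
      obtain ⟨k, hk, hm, hm', hin⟩ := Datum.exists_isInit_of_not_compat (hcode i) hi
      obtain ⟨l, hl, hl1, hl2, hin'⟩ := Datum.exists_isInit_of_not_compat (hcode j) hj
      have hki := (d i (Quotient.out x i)).len_mem k hk hm
      have hlj := (d j (Quotient.out x j)).len_mem l hl hl1
      -- Suppose both coordinates clash. The longer of the two shorter sequences has an entry at the
      -- length of the other. By equality of colours, its extension has the same entry at the length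
      -- of the other's extension. Injectivity makes these lengths equal, which is absurd. Equal
      -- lengths are excluded by disjointness of the `S i`.
      rcases lt_trichotomy ((d i (Quotient.out x i)).seq k).len
        ((d j (Quotient.out x j)).seq l).len with hlt | heq | hlt
      · obtain ⟨v, hv⟩ := exists_val_eq_some hlt
        exact hin.1.ne (index_eq (Or.inl hin') hv ((hval j i l k).symm.trans hv))
      · rw [heq] at hki
        exact Set.disjoint_left.1 (hS hij) hki hlj
      · obtain ⟨v, hv⟩ := exists_val_eq_some hlt
        exact hin'.1.ne (index_eq (Or.inl hin) hv ((hval i j k l).symm.trans hv))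
    have hall : ∀ᶠ i in (D : Filter ι), (∀ x ∈ s, Quotient.out x i ≠ ⊥) ∧ ∀ x ∈ s, ∀ x' ∈ s,
        (d i (Quotient.out x i)).Compat (d i (Quotient.out x' i)) := by
      refine Filter.Eventually.and ?_ ?_
      · exact (Filter.eventually_all_finset s).2 fun x hx => eventually_ne_bot (hs x hx).1
      · exact (Filter.eventually_all_finset s).2 fun x hx =>
          (Filter.eventually_all_finset s).2 fun x' hx' => hcompat x hx x' hx'
    rw [finset_inf_product]
    intro h0
    have h1 : ∀ᶠ i in (D : Filter ι), (s.inf fun x => Quotient.out x i) = ⊥ :=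
      Quotient.exact' h0
    obtain ⟨i, ⟨hi1, hi2⟩, hi3⟩ := (hall.and h1).exists
    refine Datum.inf_ne_bot (s.image fun x : (D : Filter ι).Product (fun i => incompAlg Θ (S i)) =>
      Quotient.out x i) (d i) ?_ ?_ ?_
    · intro b hb
      obtain ⟨x, hx, rfl⟩ := Finset.mem_image.1 hb
      exact hd i _ (hi1 x hx)
    · intro b hb b' hb'
      obtain ⟨x, hx, rfl⟩ := Finset.mem_image.1 hb
      obtain ⟨x', hx', rfl⟩ := Finset.mem_image.1 hb'
      exact hi2 x hx x' hx'
    · rw [Finset.inf_image]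
      exact hi3
  · have h1 : #(V × Option Θ) = #Θ := by
      rw [← mul_def, mk_code_values, mk_option, add_one_eq (aleph0_le_mk Θ),
        mul_eq_self (aleph0_le_mk Θ)]
    have h2 : #(ι × ι × ℕ × ℕ) = #ι := by
      simp only [mk_prod, lift_id, lift_uzero, mk_nat, lift_aleph0, aleph0_mul_aleph0]
      simp
    rw [mk_arrow, h1, h2, lift_id, lift_id, hpow]

/-! ### Cardinality of the algebras. -/

omit [WellFoundedLT W] in
theorem mk_injSeq_le (hW : #W = succ #Θ) (hseg : ∀ x : W, #(Set.Iic x) ≤ #Θ) :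
    #(InjSeq W Θ) ≤ 2 ^ #Θ := by
  let j : InjSeq W Θ → Σ γ : W, (Set.Iio γ → Option Θ) := fun f => ⟨f.len, fun x => f.val x⟩
  have hj : Function.Injective j := by
    rintro ⟨l, v, h1, h2⟩ ⟨l', v', h1', h2'⟩ h
    obtain rfl : l = l' := congrArg Sigma.fst h
    have h3 : (fun x : Set.Iio l => v x) = fun x : Set.Iio l => v' x :=
      eq_of_heq (Sigma.mk.inj h).2
    refine InjSeq.ext rfl (funext fun x => ?_)
    rcases lt_or_ge x l with hx | hx
    · exact congrFun h3 ⟨x, hx⟩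
    · exact ((h1 x).2 hx).trans ((h1' x).2 hx).symm
  refine (mk_le_of_injective hj).trans ?_
  have hΘ := aleph0_le_mk Θ
  rw [mk_sigma]
  refine (sum_le_sum _ (fun _ => 2 ^ #Θ) fun γ => ?_).trans ?_
  · rw [← power_def, mk_option, add_one_eq hΘ, ← power_self_eq hΘ]
    exact power_le_power_left (mk_ne_zero _)
      ((mk_le_mk_of_subset Set.Iio_subset_Iic_self).trans (hseg γ))
  · rw [sum_const', hW]
    refine (mul_le_mul_left (succ_le_of_lt (cantor _)) _).trans (mul_eq_self ?_).le
    exact hΘ.trans (cantor _).le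

omit [WellFoundedLT W] in
theorem mk_incompAlg (hW : #W = succ #Θ) (hseg : ∀ x : W, #(Set.Iic x) ≤ #Θ) {S : Set W}
    {γ : W} (hγ : γ ∈ S) (hmk : #(Set.Iio γ) = #Θ) : #(incompAlg Θ S) = 2 ^ #Θ := by
  classical
  obtain ⟨e⟩ := Cardinal.eq.1 hmk
  obtain ⟨p⟩ : Nonempty (Θ × ULift.{u} Bool ≃ Θ) := by
    rw [← Cardinal.eq, ← mul_def]
    refine mul_eq_left (aleph0_le_mk Θ) ?_ (mk_ne_zero _)
    rw [mk_fintype]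
    exact natCast_lt_aleph0.le.trans (aleph0_le_mk Θ)
  -- `Z` is coded by a sequence of length `γ` whose entry at the position of `t` encodes `t` and
  -- whether `t ∈ Z`; the first component ensures injectivity.
  let F : Set Θ → W → Θ := fun Z x =>
    if h : x < γ then p (e ⟨x, h⟩, ⟨decide (e ⟨x, h⟩ ∈ Z)⟩) else Classical.arbitrary Θ
  have hF : ∀ Z, Set.InjOn (F Z) (Set.Iio γ) := by
    intro Z x (hx : x < γ) y (hy : y < γ) h
    simp only [F, dif_pos hx, dif_pos hy] at h
    exact congrArg Subtype.val (e.injective (congrArg Prod.fst (p.injective h)))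
  let Φ : Set Θ → InjSeq W Θ := fun Z => ofFun (F Z) γ (hF Z)
  have hΦ : Function.Injective Φ := by
    intro Z Z' h
    ext t
    have h1 : (e.symm t : W) < γ := (e.symm t).2
    have h2 := congrFun (congrArg InjSeq.val h) (e.symm t)
    simp only [Φ, ofFun, if_pos h1, F, dif_pos h1, Option.some.injEq] at h2
    have h3 : e ⟨e.symm t, h1⟩ = t := e.apply_symm_apply t
    simpa [h3] using congrArg Prod.snd (p.injective h2)
  have hT : (2 : Cardinal) ^ #Θ ≤ #(InjSeq W Θ) := by
    rw [← mk_set]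
    exact mk_le_of_injective hΦ
  have hTi : Infinite (InjSeq W Θ) := by
    rw [infinite_iff]
    exact ((aleph0_le_mk Θ).trans (cantor _).le).trans hT
  apply le_antisymm
  · choose H hH using fun b : incompAlg Θ S => b.2
    -- An element is determined by a finite support and the traces of its members on it.
    let k : incompAlg Θ S → Finset (InjSeq W Θ) × Finset (Finset (InjSeq W Θ)) := fun b =>
      (H b, (H b).powerset.filter fun t => ∃ a ∈ b.1, ∀ f ∈ H b, f ∈ a.1 ↔ f ∈ t)
    have hk : Function.Injective k := by
      have key : ∀ b b' : incompAlg Θ S, k b = k b' → ∀ a ∈ b.1, a ∈ b'.1 := by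
        intro b b' h a ha
        have h1 : H b = H b' := congrArg Prod.fst h
        have h2 : (H b).filter (fun f => f ∈ a.1) ∈ (k b).2 := by
          refine Finset.mem_filter.2 ⟨Finset.mem_powerset.2 (Finset.filter_subset _ _),
            a, ha, fun f hf => ?_⟩
          simp [hf]
        rw [h] at h2
        obtain ⟨a', ha', h3⟩ := (Finset.mem_filter.1 h2).2
        refine (hH b' a' a fun f hf => (h3 f hf).trans ?_).1 ha'
        rw [h1]
        simp [hf]
      intro b b' h
      exact Subtype.ext (Set.ext fun a => ⟨key b b' h a, key b' b h.symm a⟩)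
    refine (mk_le_of_injective hk).trans ?_
    rw [← mul_def, mk_finset_of_infinite, mk_finset_of_infinite, mk_finset_of_infinite,
      mul_eq_self (aleph0_le_mk _)]
    exact mk_injSeq_le hW hseg
  · rw [← mk_set]
    exact mk_le_of_injective (f := fun Z => gen S (Φ Z)) fun Z Z' h => hΦ (gen_injOn S hγ hγ h)

end InjSeq

/-! ### Cardinal arithmetic and conclusion. -/

theorem exists_wellOrder_succ (μ : Cardinal.{u}) (hμ : ℵ₀ ≤ μ) :
    ∃ (W : Type u) (_ : LinearOrder W) (_ : WellFoundedLT W), #W = succ μ ∧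
      (∀ x : W, #(Set.Iic x) ≤ μ) ∧ ∃ x : W, #(Set.Iio x) = μ := by
  have hord : ord #(succ μ).ord.ToType =
      Ordinal.type (α := (succ μ).ord.ToType) (· < ·) := by
    rw [mk_ord_toType, Ordinal.type_toType]
  refine ⟨(succ μ).ord.ToType, inferInstance, inferInstance, mk_ord_toType _, fun x => ?_, ?_⟩
  · have h := (mk_Iio_lt x hord).trans_eq (mk_ord_toType _)
    rw [lt_succ_iff] at h
    rw [← Set.Iio_insert]
    refine mk_insert_le.trans ((add_le_add_left h 1).trans ?_)
    rw [add_one_eq hμ]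
  · have hlt : μ.ord < Ordinal.type (α := (succ μ).ord.ToType) (· < ·) := by
      rw [Ordinal.type_toType]
      exact ord_lt_ord.2 (lt_succ μ)
    refine ⟨Ordinal.enum (· < ·) ⟨_, hlt⟩, ?_⟩
    have h := congrArg Ordinal.card
      (Ordinal.typein_enum (α := (succ μ).ord.ToType) (· < ·) hlt)
    rwa [card_ord] at h

theorem exists_boolean_algebras {ι : Type u} [Infinite ι] (θ : Cardinal.{u}) (hθ : ℵ₀ ≤ θ)
    (hpow : θ ^ #ι = θ) :
    ∃ (B : ι → Type u) (_ : ∀ γ, BooleanAlgebra (B γ)),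
      (∀ γ, #(B γ) = 2 ^ θ ∧ topDensity (B γ) = succ θ ∧ finDensity 2 (B γ) = succ θ) ∧
      ∀ D : Ultrafilter ι, (∀ γ, D ≠ pure γ) →
        topDensity ((D : Filter ι).Product B) ≤ θ := by
  induction θ using Cardinal.inductionOn with
  | _ Θ =>
  obtain ⟨W, _, _, hW, hseg, γ₀, hγ₀⟩ := exists_wellOrder_succ #Θ hθ
  have hΘi : Infinite Θ := by rwa [infinite_iff]
  have hWΘ : #Θ < #W := hW ▸ lt_succ _
  have hIio : ∀ x : W, #(Set.Iio x) ≤ #Θ := fun x =>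
    (mk_le_mk_of_subset Set.Iio_subset_Iic_self).trans (hseg x)
  have hι : #ι ≤ #Θ := by
    rw [← hpow]
    exact (cantor #ι).le.trans (power_le_power_right (ofNat_lt_aleph0.le.trans hθ))
  obtain ⟨S, hS, hdisj⟩ := InjSeq.exists_disjoint_not_special hWΘ hseg ι hι
  -- Otherwise `S i` lies below `γ₀`, so it has at most `#Θ` elements and is special.
  have hγ : ∀ i, ∃ γ ∈ S i, #(Set.Iio γ) = #Θ := by
    intro i
    by_contra! hcon
    refine hS i (InjSeq.special_of_mk_le ((mk_le_mk_of_subset fun x hx => ?_).trans (hIio γ₀)))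
    by_contra hx'
    refine hcon x hx ((hIio x).antisymm (hγ₀.ge.trans ?_))
    exact mk_le_mk_of_subset (Set.Iio_subset_Iio (not_lt.1 hx'))
  have hne : Nonempty (InjSeq W Θ) := by
    by_contra hcon
    rw [not_nonempty_iff] at hcon
    exact InjSeq.not_special_univ hWΘ ⟨fun _ => Classical.arbitrary Θ, fun f => hcon.elim f⟩
  have hω : #Θ ^ ℵ₀ = #Θ := by
    refine le_antisymm ?_ (self_le_power _ one_le_aleph0)
    conv_rhs => rw [← hpow]
    exact power_le_power_left (aleph0_pos.trans_le hθ).ne' (aleph0_le_mk ι)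
  refine ⟨fun i => InjSeq.incompAlg Θ (S i), fun i => inferInstance, fun i => ?_, fun D hD => ?_⟩
  · obtain ⟨γ, hγS, hγΘ⟩ := hγ i
    have h1 := InjSeq.topDensity_incompAlg_le (Θ := Θ) (S i) hW hω
    have h2 := InjSeq.succ_le_finDensity_two (hS i)
    have h3 := finDensity_le_topDensity 2 (InjSeq.incompAlg Θ (S i))
    exact ⟨InjSeq.mk_incompAlg hW hseg hγS hγΘ, h1.antisymm (h2.trans h3),
      (h3.trans h1).antisymm h2⟩
  · exact InjSeq.topDensity_product_le hpow S hdisj D hD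

/-- Hausdorff's argument: with c = 2^ℵ₀, a countable sequence in c⁺ is bounded, so there are at most
c⁺ · c^ℵ₀ = c⁺ of them. -/
theorem succ_continuum_power_aleph0 :
    succ (2 ^ ℵ₀ : Cardinal.{0}) ^ ℵ₀ = succ (2 ^ ℵ₀) := by
  have hc : ℵ₀ ≤ (2 ^ ℵ₀ : Cardinal.{0}) := (cantor _).le
  refine le_antisymm ?_ (self_le_power _ one_le_aleph0)
  let c : Cardinal.{0} := 2 ^ ℵ₀
  obtain ⟨W, _, _, hW, hIic, -⟩ := exists_wellOrder_succ c hc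
  have hbdd : ∀ f : ℕ → W, ∃ x, ∀ n, f n < x := by
    intro f
    by_contra! hcon
    have h1 : (Set.univ : Set W) ⊆ ⋃ n, Set.Iic (f n) := fun x _ =>
      Set.mem_iUnion.2 (hcon x)
    have h2 := (mk_le_mk_of_subset h1).trans (mk_iUnion_le _)
    have h4 := h2.trans (mul_le_mul_right (ciSup_le' fun n => hIic (f n)) _)
    rw [mk_univ, hW, mk_nat, mul_eq_right hc hc aleph0_ne_zero] at h4
    exact (lt_succ c).not_ge h4
  choose b hb using hbdd
  let j : (ℕ → W) → Σ x : W, (ℕ → Set.Iio x) := fun f => ⟨b f, fun n => ⟨f n, hb f n⟩⟩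
  have hj : Function.Injective j := by
    intro f g h
    have key : ∀ n, ((j f).2 n : W) = (j g).2 n := fun n => by rw [h]
    exact funext key
  have h5 := mk_le_of_injective hj
  rw [← power_def, mk_nat, hW, mk_sigma] at h5
  refine h5.trans ((sum_le_sum _ (fun _ => c) fun x => ?_).trans ?_)
  · rw [← power_def, mk_nat]
    refine (power_le_power_right
      ((mk_le_mk_of_subset Set.Iio_subset_Iic_self).trans (hIic x))).trans ?_
    rw [← power_mul, aleph0_mul_aleph0]
  · rw [sum_const', hW, mul_eq_left (hc.trans (le_succ c)) (le_succ c)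
      (aleph0_pos.trans_le hc).ne']

theorem mainTheorem2 :
    (∀ {ι : Type u} [Infinite ι] (θ : Cardinal.{u}), θ.IsRegular → θ ^ #ι = θ →
      ∃ (B : ι → Type u) (_ : ∀ γ, BooleanAlgebra (B γ)),
        (∀ γ, #(B γ) = 2 ^ θ ∧ topDensity (B γ) = succ θ ∧ finDensity 2 (B γ) = succ θ) ∧
        ∀ D : Ultrafilter ι, (∀ γ, D ≠ pure γ) →
          topDensity ((D : Filter ι).Product B) ≤ θ) ∧
    (∃ (B : ℕ → Type) (_ : ∀ n, BooleanAlgebra (B n)),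
      (∀ n, #(B n) = 2 ^ succ (2 ^ ℵ₀ : Cardinal.{0}) ∧
        topDensity (B n) = succ (succ (2 ^ ℵ₀ : Cardinal.{0})) ∧
        finDensity 2 (B n) = succ (succ (2 ^ ℵ₀ : Cardinal.{0}))) ∧
      ∀ D : Ultrafilter ℕ, (∀ n, D ≠ pure n) →
        topDensity ((D : Filter ℕ).Product B) ≤ succ (2 ^ ℵ₀ : Cardinal.{0})) := by
  refine ⟨fun θ hθ hpow => exists_boolean_algebras θ hθ.aleph0_le hpow, ?_⟩
  refine exists_boolean_algebras _ ((cantor ℵ₀).le.trans (le_succ _)) ?_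
  rw [mk_nat]
  exact succ_continuum_power_aleph0
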